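/- For a Tychonoff space $Z$, let $C(Z)$ be the set of continuous real-valued functions on $Z$. Let $w(Z)$ be the weight of $Z$, that is, the least cardinality of a base of $Z$. Let $nw(Z)$ be the network weight of $Z$, that is, the least cardinality of a network of $Z$, where a network is a family $\mathcal N$ of subsets of $Z$ such that whenever $x\in U$ with $U$ open in $Z$, there is $M\in\mathcal N$ with $x\in M\subseteq U$. Let $\beta Z$ be the Stone–Čech compactification of $Z$, and let the Nagami number $Nag(Z)$ be the least cardinality of a family $\mathcal F$ of closed subsets of $\beta Z$ such that for all $x\in Z$ and $y\in\beta Z\setminus Z$ there is $F\in\mathcal F$ with $x\in F$ and $y\notin F$. As usual for cardinal functions, the values of $w$, $nw$ and $Nag$ are understood to be infinite: a finite minimum is replaced by $\omega$. The space $Z$ is called a Lindelöf $\Sigma$-space if $Nag(Z)\le\omega$. **Theorem.** If $Y$ is a dense subspace of a Tychonoff space $X$, then $$|C(X)|\le nw(Y)^{Nag(Y)}\qquad\text{and}\qquad w(X)\le nw(Y)^{Nag(Y)}.$$ In particular, if $Y$ is a Lindelöf $\Sigma$-space, then $w(X)\le nw(Y)^{\omega}$. -/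

import Mathlib

universe u

/-- A network of a topological space: a family of (arbitrary) subsets such that every point of
every open set lies in some member of the family contained in that open set. -/
def IsTopNetwork {X : Type u} [TopologicalSpace X] (N : Set (Set X)) : Prop :=
  ∀ (x : X) (U : Set X), IsOpen U → x ∈ U → ∃ M ∈ N, x ∈ M ∧ M ⊆ U

/-- The weight `w(X)`: the least cardinality of a base, taken to be at least `ℵ₀` according to the
usual convention that the values of cardinal functions are infinite cardinals. -/
noncomputable def topWeight (X : Type u) [TopologicalSpace X] : Cardinal.{u} :=
  max Cardinal.aleph0
    (sInf {κ : Cardinal.{u} | ∃ B : Set (Set X),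
      TopologicalSpace.IsTopologicalBasis B ∧ Cardinal.mk B = κ})

/-- The network weight `nw(X)`: the least cardinality of a network, taken to be at least `ℵ₀`
according to the usual convention that the values of cardinal functions are infinite cardinals. -/
noncomputable def networkWeight (X : Type u) [TopologicalSpace X] : Cardinal.{u} :=
  max Cardinal.aleph0
    (sInf {κ : Cardinal.{u} | ∃ N : Set (Set X), IsTopNetwork N ∧ Cardinal.mk N = κ})

/-- A family of subsets of the Stone–Čech compactification `βX` separates the points of `X`
from `βX \ X`, where `X` is identified with its image under the canonical map `X → βX`. -/
def SeparatesFromRemainder {X : Type u} [TopologicalSpace X] (F : Set (Set (StoneCech X))) : Prop :=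
  ∀ (x : X) (y : StoneCech X), y ∉ Set.range (stoneCechUnit : X → StoneCech X) →
    ∃ A ∈ F, stoneCechUnit x ∈ A ∧ y ∉ A

/-- The Nagami number `Nag(X)` of a Tychonoff space: the least cardinality of a family of closed
subsets of `βX` that separates the points of `X` from `βX \ X`, taken to be at least `ℵ₀` according
to the usual convention that the values of cardinal functions are infinite cardinals. (The
convention matters only for compact `X`, where the empty family separates.) -/
noncomputable def nagamiNumber (X : Type u) [TopologicalSpace X] : Cardinal.{u} :=
  max Cardinal.aleph0
    (sInf {κ : Cardinal.{u} | ∃ F : Set (Set (StoneCech X)),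
      (∀ A ∈ F, IsClosed A) ∧ SeparatesFromRemainder F ∧ Cardinal.mk F = κ})

/-- A (Tychonoff) space is a Lindelöf Σ-space if its Nagami number is at most `ℵ₀`. -/
def IsLindelofSigma (X : Type u) [TopologicalSpace X] : Prop :=
  nagamiNumber X ≤ Cardinal.aleph0

/-! Restriction to the dense set `Y` embeds `C(X)` into `C(Y)`, and cozero sets form a base of `X`,
so everything reduces to bounding `|C(Y)|`. A network of size `κ` yields a lattice `B` of at most
`κ` open sets separating disjoint compacta (`IsTopNetwork.exists_open_separating_compacts`). A
family `F` of size `μ` surrounds each point by a compact trace, approximated by finite traces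
(`SeparatesFromRemainder.exists_finiteTrace_subset`). Code `f` by choosing, for each finite trace
and rationals `p`, `q`, a disjoint pair from `B` enclosing `{f ≤ p}` and `{f ≥ q}` on that trace, if
one exists. There are at most `κ ^ μ` codes, and the code determines `f`. -/

open Set Topology
open Cardinal hiding univ

section Cardinality

/-- A type of cardinality at most `κ ≥ ℵ₀` has at most `κ` finite subsets. -/
theorem mk_finset_le_of_le {α : Type u} {κ : Cardinal.{u}} (hκ : ℵ₀ ≤ κ) (h : #α ≤ κ) :
    #(Finset α) ≤ κ := by
  cases finite_or_infinite α
  · exact (Cardinal.lt_aleph0_of_finite _).le.trans hκ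
  · rwa [mk_finset_of_infinite]

theorem mk_supClosure_le {α : Type u} [SemilatticeSup α] {s : Set α} {κ : Cardinal.{u}}
    (hκ : ℵ₀ ≤ κ) (h : #s ≤ κ) : #(supClosure s) ≤ κ := by
  classical
  let g : {t : Finset s // t.Nonempty} → α := fun t => t.1.sup' t.2 Subtype.val
  have hsub : supClosure s ⊆ range g := by
    refine supClosure_min (fun a ha => ⟨⟨{⟨a, ha⟩}, by simp⟩, by simp [g]⟩) ?_
    rintro _ ⟨t, rfl⟩ _ ⟨t', rfl⟩
    exact ⟨⟨t.1 ∪ t'.1, t.2.mono Finset.subset_union_left⟩, Finset.sup'_union t.2 t'.2 _⟩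
  calc #(supClosure s) ≤ #(range g) := mk_le_mk_of_subset hsub
    _ ≤ #{t : Finset s // t.Nonempty} := mk_range_le
    _ ≤ #(Finset s) := mk_subtype_le _
    _ ≤ κ := mk_finset_le_of_le hκ h

theorem mk_infClosure_le {α : Type u} [SemilatticeInf α] {s : Set α} {κ : Cardinal.{u}}
    (hκ : ℵ₀ ≤ κ) (h : #s ≤ κ) : #(infClosure s) ≤ κ :=
  mk_supClosure_le (α := αᵒᵈ) hκ h

theorem mk_latticeClosure_le {α : Type u} [DistribLattice α] {s : Set α} {κ : Cardinal.{u}}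
    (hκ : ℵ₀ ≤ κ) (h : #s ≤ κ) : #(latticeClosure s) ≤ κ := by
  rw [← supClosure_infClosure]
  exact mk_supClosure_le hκ (mk_infClosure_le hκ h)

end Cardinality

section Separation

variable {Y : Type u} [TopologicalSpace Y]

/-- A Hausdorff space with a network of size at most `κ` has at most `κ` open sets that
suffice to separate any two distinct points. -/
theorem IsTopNetwork.exists_open_separating [T2Space Y] {N : Set (Set Y)} (hN : IsTopNetwork N)
    {κ : Cardinal.{u}} (hκ : ℵ₀ ≤ κ) (hNκ : #N ≤ κ) :
    ∃ O : Set (Set Y), #O ≤ κ ∧ (∀ U ∈ O, IsOpen U) ∧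
      ∀ x y, x ≠ y → ∃ U ∈ O, ∃ V ∈ O, x ∈ U ∧ y ∈ V ∧ Disjoint U V := by
  have key : ∀ p : N × N, ∃ U V : Set Y, IsOpen U ∧ IsOpen V ∧ Disjoint U V ∧
      (SeparatedNhds p.1.1 p.2.1 → p.1.1 ⊆ U ∧ p.2.1 ⊆ V) := by
    intro p
    by_cases h : SeparatedNhds p.1.1 p.2.1
    · obtain ⟨U, V, hU, hV, h1, h2, hd⟩ := h
      exact ⟨U, V, hU, hV, hd, fun _ => ⟨h1, h2⟩⟩
    -- Inseparable pairs get a harmless default.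
    · exact ⟨∅, ∅, isOpen_empty, isOpen_empty, disjoint_bot_left, fun h' => (h h').elim⟩
  choose U V hU hV hd hsub using key
  have hNN : #(N × N) ≤ κ := by
    rw [mk_prod, lift_id]
    exact (mul_le_mul' hNκ hNκ).trans (mul_eq_self hκ).le
  refine ⟨range U ∪ range V, ?_, ?_, ?_⟩
  · exact (mk_union_le _ _).trans ((add_le_add (mk_range_le.trans hNN)
      (mk_range_le.trans hNN)).trans (add_eq_self hκ).le)
  · rintro _ (⟨p, rfl⟩ | ⟨p, rfl⟩)
    exacts [hU p, hV p]
  · intro x y hxy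
    obtain ⟨A, B, hA, hB, hxA, hyB, hAB⟩ := t2_separation hxy
    obtain ⟨M, hM, hxM, hMA⟩ := hN x A hA hxA
    obtain ⟨M', hM', hyM, hMB⟩ := hN y B hB hyB
    have := hsub (⟨M, hM⟩, ⟨M', hM'⟩) ⟨A, B, hA, hB, hMA, hMB, hAB⟩
    exact ⟨_, .inl ⟨_, rfl⟩, _, .inr ⟨_, rfl⟩, this.1 hxM, this.2 hyM, hd _⟩

/-- A sublattice of open sets separating points from each other separates disjoint compact sets. -/
theorem exists_mem_separating_compacts {B : Set (Set Y)} (hB : IsSublattice B)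
    (h0 : ∅ ∈ B) (h1 : univ ∈ B) (hopen : ∀ U ∈ B, IsOpen U)
    (hsep : ∀ x y, x ≠ y → ∃ U ∈ B, ∃ V ∈ B, x ∈ U ∧ y ∈ V ∧ Disjoint U V)
    {K L : Set Y} (hK : IsCompact K) (hL : IsCompact L) (hKL : Disjoint K L) :
    ∃ G ∈ B, ∃ H ∈ B, K ⊆ G ∧ L ⊆ H ∧ Disjoint G H := by
  have point : ∀ x ∉ L, ∃ G ∈ B, ∃ H ∈ B, x ∈ G ∧ L ⊆ H ∧ Disjoint G H := by
    intro x hx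
    refine hL.induction_on (p := fun L => ∃ G ∈ B, ∃ H ∈ B, x ∈ G ∧ L ⊆ H ∧ Disjoint G H)
      ⟨univ, h1, ∅, h0, mem_univ x, Subset.rfl, disjoint_bot_right⟩ ?_ ?_ ?_
    · rintro s t hst ⟨G, hG, H, hH, hx, ht, hd⟩
      exact ⟨G, hG, H, hH, hx, hst.trans ht, hd⟩
    · rintro s t ⟨G, hG, H, hH, hx, hs, hd⟩ ⟨G', hG', H', hH', hx', ht, hd'⟩
      exact ⟨G ∩ G', hB.infClosed hG hG', H ∪ H', hB.supClosed hH hH', ⟨hx, hx'⟩,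
        union_subset_union hs ht,
        disjoint_union_right.2 ⟨hd.mono_left inter_subset_left, hd'.mono_left inter_subset_right⟩⟩
    · intro y hy
      obtain ⟨G, hG, H, hH, hxG, hyH, hd⟩ := hsep x y (fun h => hx (h ▸ hy))
      exact ⟨H, mem_nhdsWithin_of_mem_nhds ((hopen H hH).mem_nhds hyH), G, hG, H, hH, hxG,
        Subset.rfl, hd⟩
  refine hK.induction_on (p := fun K => ∃ G ∈ B, ∃ H ∈ B, K ⊆ G ∧ L ⊆ H ∧ Disjoint G H)
    ⟨∅, h0, univ, h1, Subset.rfl, subset_univ L, disjoint_bot_left⟩ ?_ ?_ ?_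
  · rintro s t hst ⟨G, hG, H, hH, ht, hL, hd⟩
    exact ⟨G, hG, H, hH, hst.trans ht, hL, hd⟩
  · rintro s t ⟨G, hG, H, hH, hs, hx, hd⟩ ⟨G', hG', H', hH', ht, hx', hd'⟩
    exact ⟨G ∪ G', hB.supClosed hG hG', H ∩ H', hB.infClosed hH hH',
      union_subset_union hs ht, subset_inter hx hx',
      disjoint_union_left.2 ⟨hd.mono_right inter_subset_left, hd'.mono_right inter_subset_right⟩⟩
  · intro x hx
    obtain ⟨G, hG, H, hH, hxG, hyH, hd⟩ := point x (hKL.notMem_of_mem_left hx)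
    exact ⟨G, mem_nhdsWithin_of_mem_nhds ((hopen G hG).mem_nhds hxG), G, hG, H, hH,
      Subset.rfl, hyH, hd⟩

/-- A Hausdorff space with a network of size at most `κ` has at most `κ` open sets that
suffice to separate any two disjoint compact sets. -/
theorem IsTopNetwork.exists_open_separating_compacts [T2Space Y] {N : Set (Set Y)}
    (hN : IsTopNetwork N) {κ : Cardinal.{u}} (hκ : ℵ₀ ≤ κ) (hNκ : #N ≤ κ) :
    ∃ B : Set (Set Y), #B ≤ κ ∧ ∅ ∈ B ∧ (∀ U ∈ B, IsOpen U) ∧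
      ∀ K L, IsCompact K → IsCompact L → Disjoint K L →
        ∃ G ∈ B, ∃ H ∈ B, K ⊆ G ∧ L ⊆ H ∧ Disjoint G H := by
  obtain ⟨O, hOκ, hO, hsep⟩ := hN.exists_open_separating hκ hNκ
  -- `∅` and `univ` start the inductions over compact sets.
  let O' : Set (Set Y) := insert ∅ (insert univ O)
  have hO'κ : #O' ≤ κ :=
    mk_insert_le.trans (add_le_of_le hκ (mk_insert_le.trans
      (add_le_of_le hκ hOκ (one_le_aleph0.trans hκ))) (one_le_aleph0.trans hκ))
  have hsub : O' ⊆ latticeClosure O' := subset_latticeClosure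
  have hOsub : O ⊆ latticeClosure O' := fun U hU => hsub (.inr (.inr hU))
  have hopen : latticeClosure O' ⊆ {U | IsOpen U} := by
    refine latticeClosure_min ?_ ⟨fun _ h _ h' => IsOpen.union h h', fun _ h _ h' => IsOpen.inter h h'⟩
    rintro U (rfl | rfl | hU)
    exacts [isOpen_empty, isOpen_univ, hO U hU]
  refine ⟨latticeClosure O', mk_latticeClosure_le hκ hO'κ, hsub (.inl rfl), hopen,
    fun K L hK hL hd => exists_mem_separating_compacts isSublattice_latticeClosure
      (hsub (.inl rfl)) (hsub (.inr (.inl rfl))) hopen ?_ hK hL hd⟩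
  intro x y hxy
  obtain ⟨U, hU, V, hV, h⟩ := hsep x y hxy
  exact ⟨U, hOsub hU, V, hOsub hV, h⟩

end Separation

section Remainder

variable {Y : Type u} [TopologicalSpace Y]

/-- The trace on `Y` of the intersection of finitely many subsets of `βY`. -/
def finiteTrace {F : Set (Set (StoneCech Y))} (s : Finset F) : Set Y :=
  {y | ∀ A ∈ s, stoneCechUnit y ∈ A.1}

theorem finiteTrace_anti {F : Set (Set (StoneCech Y))} {s t : Finset F} (h : s ⊆ t) :
    finiteTrace t ⊆ finiteTrace s :=
  fun _ hy A hA => hy A (h hA)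

/-- The trace on `Y` of the intersection of all members of `F` that contain `x`. -/
def fullTrace (F : Set (Set (StoneCech Y))) (x : Y) : Set Y :=
  {y | ∀ A ∈ F, stoneCechUnit x ∈ A → stoneCechUnit y ∈ A}

variable [T35Space Y] {F : Set (Set (StoneCech Y))}

/-- Each remainder point is missed by some member of `F` containing `x`, so the members containing
`x` intersect inside `Y`; that intersection is closed in the compact `βY`. -/
theorem SeparatesFromRemainder.isCompact_fullTrace (hF : SeparatesFromRemainder F)
    (hFc : ∀ A ∈ F, IsClosed A) (x : Y) : IsCompact (fullTrace F x) := by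
  have himg : stoneCechUnit '' fullTrace F x = ⋂ A ∈ {A ∈ F | stoneCechUnit x ∈ A}, A := by
    ext z
    simp only [mem_image, mem_iInter]
    constructor
    · rintro ⟨y, hy, rfl⟩ A hA
      exact hy A hA.1 hA.2
    · intro hz
      by_cases hr : z ∈ range (stoneCechUnit : Y → StoneCech Y)
      · obtain ⟨y, rfl⟩ := hr
        exact ⟨y, fun A hA hx => hz A ⟨hA, hx⟩, rfl⟩
      · obtain ⟨A, hA, hxA, hzA⟩ := hF x z hr
        exact (hzA (hz A ⟨hA, hxA⟩)).elim
  rw [isEmbedding_stoneCechUnit.isCompact_iff, himg]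
  exact (isClosed_biInter fun A hA => hFc A hA.1).isCompact

/-- Compactness of `βY`: the closure of `C`, the complement of an open extension of `G` and the
members of `F` containing `x` have empty intersection, so finitely many of those members suffice. -/
theorem SeparatesFromRemainder.exists_finiteTrace_subset (hF : SeparatesFromRemainder F)
    (hFc : ∀ A ∈ F, IsClosed A) {x : Y} {C G : Set Y} (hC : IsClosed C) (hG : IsOpen G)
    (h : C ∩ fullTrace F x ⊆ G) :
    ∃ s : Finset F, x ∈ finiteTrace s ∧ C ∩ finiteTrace s ⊆ G := by
  obtain ⟨G', hG', rfl⟩ := isEmbedding_stoneCechUnit.isOpen_iff.1 hG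
  have hcl : ∀ y : Y, stoneCechUnit y ∈ closure (stoneCechUnit '' C) → y ∈ C := fun y hy => by
    rwa [← mem_preimage, ← isEmbedding_stoneCechUnit.closure_eq_preimage_closure_image,
      hC.closure_eq] at hy
  have hcomp : IsCompact (closure (stoneCechUnit '' C) ∩ G'ᶜ) :=
    (isClosed_closure.inter hG'.isClosed_compl).isCompact
  obtain ⟨u, hu⟩ := hcomp.elim_finite_subfamily_closed
    (fun A : {A : F // stoneCechUnit x ∈ A.1} => A.1.1) (fun A => hFc _ A.1.2) (by
      rw [eq_empty_iff_forall_notMem]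
      rintro z ⟨⟨hzC, hzG⟩, hz⟩
      rw [mem_iInter] at hz
      by_cases hr : z ∈ range (stoneCechUnit : Y → StoneCech Y)
      · obtain ⟨y, rfl⟩ := hr
        exact hzG (h ⟨hcl y hzC, fun A hA hx => hz ⟨⟨A, hA⟩, hx⟩⟩)
      · obtain ⟨A, hA, hxA, hzA⟩ := hF x z hr
        exact hzA (hz ⟨⟨A, hA⟩, hxA⟩))
  refine ⟨u.map (Function.Embedding.subtype _), ?_, ?_⟩
  · intro A hA
    obtain ⟨a, -, rfl⟩ := Finset.mem_map.1 hA
    exact a.2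
  · rintro y ⟨hyC, hy⟩
    by_contra hyG
    refine eq_empty_iff_forall_notMem.1 hu (stoneCechUnit y)
      ⟨⟨subset_closure (mem_image_of_mem _ hyC), hyG⟩, ?_⟩
    simp only [mem_iInter]
    exact fun A hA => hy A.1 (Finset.mem_map_of_mem _ hA)

end Remainder

section ContinuousFunctions

/-- The cardinality of `C(Y)` is bounded in terms of a network of `Y` and a family of closed
subsets of `βY` separating `Y` from its remainder. -/
theorem mk_continuousMap_le_of_network {Y : Type u} [TopologicalSpace Y] [T35Space Y]
    {N : Set (Set Y)} (hN : IsTopNetwork N) {F : Set (Set (StoneCech Y))}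
    (hFc : ∀ A ∈ F, IsClosed A) (hF : SeparatesFromRemainder F) {κ μ : Cardinal.{u}}
    (hκ : ℵ₀ ≤ κ) (hμ : ℵ₀ ≤ μ) (hNκ : #N ≤ κ) (hFμ : #F ≤ μ) : #C(Y, ℝ) ≤ κ ^ μ := by
  classical
  obtain ⟨B, hBκ, h0, hopen, hsep⟩ := hN.exists_open_separating_compacts hκ hNκ
  let good (f : C(Y, ℝ)) (i : Finset F × ℚ × ℚ) (P : B × B) : Prop :=
    {y | f y ≤ i.2.1} ∩ finiteTrace i.1 ⊆ P.1.1 ∧ {y | i.2.2 ≤ f y} ∩ finiteTrace i.1 ⊆ P.2.1 ∧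
      Disjoint P.1.1 P.2.1
  have exists_good : ∀ (f : C(Y, ℝ)) (p q : ℚ), p < q → ∀ x : Y,
      ∃ s : Finset F, x ∈ finiteTrace s ∧ ∃ P, good f (s, p, q) P := by
    intro f p q hpq x
    have hC := hF.isCompact_fullTrace hFc x
    have hle : IsClosed {y | f y ≤ p} := isClosed_le f.continuous continuous_const
    have hge : IsClosed {y | q ≤ f y} := isClosed_le continuous_const f.continuous
    obtain ⟨G, hG, H, hH, hAG, hBH, hd⟩ := hsep _ _ (hC.inter_left hle) (hC.inter_left hge) (by
      rw [Set.disjoint_left]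
      rintro y ⟨hy, -⟩ ⟨hy', -⟩
      have : (q : ℝ) ≤ p := le_trans hy' hy
      exact absurd (Rat.cast_le.1 this) (not_le.2 hpq))
    obtain ⟨s, hxs, hs⟩ := hF.exists_finiteTrace_subset hFc hle (hopen G hG) hAG
    obtain ⟨t, hxt, ht⟩ := hF.exists_finiteTrace_subset hFc hge (hopen H hH) hBH
    refine ⟨s ∪ t, fun A hA => (Finset.mem_union.1 hA).elim (hxs A) (hxt A),
      (⟨G, hG⟩, ⟨H, hH⟩), ?_, ?_, hd⟩
    · exact (inter_subset_inter_right _ (finiteTrace_anti Finset.subset_union_left)).trans hs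
    · exact (inter_subset_inter_right _ (finiteTrace_anti Finset.subset_union_right)).trans ht
  let code (f : C(Y, ℝ)) (i : Finset F × ℚ × ℚ) : B × B :=
    if h : ∃ P, good f i P then h.choose else (⟨∅, h0⟩, ⟨∅, h0⟩)
  have code_good : ∀ f i, (∃ P, good f i P) → good f i (code f i) := by
    intro f i h
    simp only [code, dif_pos h]
    exact h.choose_spec
  have code_le : ∀ f g, code f = code g → ∀ x, g x ≤ f x := by
    intro f g hfg x
    by_contra! hlt
    obtain ⟨p, hfp, hpg⟩ := exists_rat_btwn hlt
    obtain ⟨q, hpq, hqg⟩ := exists_rat_btwn hpg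
    have hpq' : p < q := Rat.cast_lt.1 hpq
    obtain ⟨s, hxs, P, hP⟩ := exists_good f p q hpq' x
    obtain ⟨t, hxt, Q, hQ⟩ := exists_good g p q hpq' x
    -- Shrinking the trace keeps a pair good, so `f` and `g` can be compared at the common index `s
    -- ∪ t`.
    have mono : ∀ h : C(Y, ℝ), ∀ s' : Finset F, s' ⊆ s ∪ t → ∀ P, good h (s', p, q) P →
        good h (s ∪ t, p, q) P := fun h s' hs' P hP =>
      ⟨(inter_subset_inter_right _ (finiteTrace_anti hs')).trans hP.1,
        (inter_subset_inter_right _ (finiteTrace_anti hs')).trans hP.2.1, hP.2.2⟩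
    have hf := code_good f _ ⟨P, mono f s Finset.subset_union_left P hP⟩
    have hg := code_good g _ ⟨Q, mono g t Finset.subset_union_right Q hQ⟩
    -- One disjoint pair now serves both functions, yet `f x < p < q < g x` puts `x` in both of its
    -- members.
    rw [← hfg] at hg
    have hx : x ∈ finiteTrace (s ∪ t) :=
      fun A hA => (Finset.mem_union.1 hA).elim (hxs A) (hxt A)
    exact Set.disjoint_left.1 hf.2.2 (hf.1 ⟨hfp.le, hx⟩) (hg.2.1 ⟨hqg.le, hx⟩)
  have code_inj : Function.Injective code := fun f g h =>
    ContinuousMap.ext fun x => le_antisymm (code_le g f h.symm x) (code_le f g h x)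
  have hBB : #(B × B) ≤ κ := by
    rw [mk_prod, lift_id]
    exact (mul_le_mul' hBκ hBκ).trans (mul_eq_self hκ).le
  have hI : #(Finset F × ℚ × ℚ) ≤ μ := by
    rw [mk_prod, lift_uzero]
    refine (mul_le_mul' (mk_finset_le_of_le hμ hFμ) ?_).trans (mul_eq_self hμ).le
    rw [mk_eq_aleph0 (ℚ × ℚ), lift_aleph0]
    exact hμ
  calc #C(Y, ℝ) ≤ #(Finset F × ℚ × ℚ → B × B) := mk_le_of_injective code_inj
    _ = #(B × B) ^ #(Finset F × ℚ × ℚ) := (power_def _ _).symm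
    _ ≤ κ ^ #(Finset F × ℚ × ℚ) := power_le_power_right hBB
    _ ≤ κ ^ μ := power_le_power_left (aleph0_pos.trans_le hκ).ne' hI

theorem exists_isTopNetwork_mk_le (Y : Type u) [TopologicalSpace Y] :
    ∃ N : Set (Set Y), IsTopNetwork N ∧ #N ≤ networkWeight Y := by
  obtain ⟨N, hN, h⟩ := csInf_mem
    (s := {κ : Cardinal.{u} | ∃ N : Set (Set Y), IsTopNetwork N ∧ #N = κ})
    ⟨_, univ, fun x U _ hx => ⟨U, mem_univ U, hx, Subset.rfl⟩, rfl⟩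
  exact ⟨N, hN, h.le.trans (le_max_right _ _)⟩

theorem exists_separatesFromRemainder_mk_le (Y : Type u) [TopologicalSpace Y] :
    ∃ F : Set (Set (StoneCech Y)), (∀ A ∈ F, IsClosed A) ∧ SeparatesFromRemainder F ∧
      #F ≤ nagamiNumber Y := by
  obtain ⟨F, hFc, hF, h⟩ := csInf_mem
    (s := {κ : Cardinal.{u} | ∃ F : Set (Set (StoneCech Y)),
      (∀ A ∈ F, IsClosed A) ∧ SeparatesFromRemainder F ∧ #F = κ})
    -- The minimum is over a nonempty set: singletons of `βY` are closed.
    ⟨_, {A | IsClosed A}, fun _ h => h, fun x y hy =>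
      ⟨{stoneCechUnit x}, isClosed_singleton, rfl, fun h => hy ⟨x, h.symm⟩⟩, rfl⟩
  exact ⟨F, hFc, hF, h.le.trans (le_max_right _ _)⟩

theorem mk_continuousMap_le (Y : Type u) [TopologicalSpace Y] [T35Space Y] :
    #C(Y, ℝ) ≤ networkWeight Y ^ nagamiNumber Y := by
  obtain ⟨N, hN, hNκ⟩ := exists_isTopNetwork_mk_le Y
  obtain ⟨F, hFc, hF, hFμ⟩ := exists_separatesFromRemainder_mk_le Y
  exact mk_continuousMap_le_of_network hN hFc hF (le_max_left _ _) (le_max_left _ _) hNκ hFμ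

theorem mk_continuousMap_le_of_dense {X : Type u} [TopologicalSpace X] {Y : Set X}
    (hY : Dense Y) : #C(X, ℝ) ≤ #C(Y, ℝ) :=
  mk_le_of_injective (f := ContinuousMap.restrict Y) fun f g h =>
    ContinuousMap.ext fun x => congrFun (Continuous.ext_on hY f.continuous g.continuous
      fun y hy => DFunLike.congr_fun h (⟨y, hy⟩ : Y)) x

/-- The cozero sets form a base of a completely regular space. -/
theorem isTopologicalBasis_cozero (X : Type u) [TopologicalSpace X] [CompletelyRegularSpace X] :
    TopologicalSpace.IsTopologicalBasis (range fun f : C(X, ℝ) => {x | f x ≠ 0}) := by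
  refine TopologicalSpace.isTopologicalBasis_of_isOpen_of_nhds ?_ ?_
  · rintro _ ⟨f, rfl⟩
    exact isOpen_ne_fun f.continuous continuous_const
  · intro x U hx hU
    obtain ⟨f, hf, hfx, hfU⟩ :=
      CompletelyRegularSpace.completely_regular x Uᶜ hU.isClosed_compl (fun h => h hx)
    refine ⟨_, ⟨⟨fun y => 1 - (f y : ℝ), by fun_prop⟩, rfl⟩, by simp [hfx], fun y hy => ?_⟩
    by_contra hyU
    exact hy (by simp [hfU hyU])

theorem topWeight_le_mk_continuousMap (X : Type u) [TopologicalSpace X]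
    [CompletelyRegularSpace X] : topWeight X ≤ max ℵ₀ #C(X, ℝ) :=
  by
  refine max_le_max le_rfl (le_trans (csInf_le' ?_)
    (mk_range_le (f := fun f : C(X, ℝ) => {x | f x ≠ 0})))
  exact ⟨_, isTopologicalBasis_cozero X, rfl⟩

end ContinuousFunctions

theorem theorem2 {X : Type u} [TopologicalSpace X] [T35Space X] (Y : Set X) (hY : Dense Y) :
    Cardinal.mk C(X, ℝ) ≤ networkWeight Y ^ nagamiNumber Y ∧
      topWeight X ≤ networkWeight Y ^ nagamiNumber Y ∧
      (IsLindelofSigma Y → topWeight X ≤ networkWeight Y ^ Cardinal.aleph0.{u}) := by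
  have hnw : ℵ₀ ≤ networkWeight Y := le_max_left _ _
  have hNag : ℵ₀ ≤ nagamiNumber Y := le_max_left _ _
  have hC : #C(X, ℝ) ≤ networkWeight Y ^ nagamiNumber Y :=
    (mk_continuousMap_le_of_dense hY).trans (mk_continuousMap_le Y)
  have hw : topWeight X ≤ networkWeight Y ^ nagamiNumber Y :=
    (topWeight_le_mk_continuousMap X).trans <| max_le
      (hnw.trans (self_le_power _ (one_le_aleph0.trans hNag))) hC
  exact ⟨hC, hw, fun hS => hw.trans (power_le_power_left (aleph0_pos.trans_le hnw).ne' hS)⟩
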